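/- Let $n$ be a non-negative integer, $G$ a finite group acting on a finite set $S$, and $T\subseteq S$ a $G$-invariant subset. Write $[n]=\{1,\dots,n\}$. The $S$-Dowling poset $\mathcal D_n(G,S)$ is the following. Its elements are pairs $(\tilde\beta,z)$, where $\tilde\beta=\{\tilde B_1,\dots,\tilde B_\ell\}$ consists of pairwise disjoint non-empty subsets $B_i\subseteq[n]$, each with a class of functions $b_i\colon B_i\to G$ modulo $b_i\sim b_ig$ ($g\in G$), and $z\colon Z\to S$ is a function on the zero block $Z=[n]\setminus\bigcup_i B_i$. The order is the reflexive transitive closure of the relations (merge) $(\tilde\beta\cup\{\tilde A,\tilde B\},z)\prec(\tilde\beta\cup\{\tilde C\},z)$, where $C=A\cup B$ and $c|_A=a$, $c|_B=bg$ for some $g\in G$; and (color) $(\tilde\beta\cup\{\tilde B\},z)\prec(\tilde\beta,z')$, where $z'$ extends $z$ to $Z\cup B$ and, for some $s\in S$, $z'(i)=b(i)\cdot s$ for all $i\in B$. Its least element $\hat 0$ has all blocks singletons and $Z=\varnothing$. Let $\mathcal P_n(G,S,T)\subseteq\mathcal D_n(G,S)$ be the subposet (with the induced order) of those $(\tilde\beta,z)$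 such that $|z^{-1}(O')|\neq1$ for every $G$-orbit $O'\subseteq S\setminus T$, and let $\bar{\mathcal P}_n(G,S,T)=\mathcal P_n(G,S,T)\setminus\{\hat 0\}$. Orbit reduction. If $O\subseteq S\setminus T$ is a $G$-orbit whose points have trivial stabilizer (i.e. $|O|=|G|$), then $\bar{\mathcal P}_n(G,S,T)$ and $\bar{\mathcal P}_n(G,S\setminus O,T)$ are homotopy equivalent; that is, the geometric realizations of their order complexes (the simplicial complexes of non-empty finite chains) are homotopy equivalent. -/

import Mathlib

noncomputable section

/-! ### Projectivized `G`-colored blocks -/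

/-- A nonempty subset `B ⊆ [n]` together with a function `b : B → G`. -/
structure ColoredSet (n : ℕ) (G : Type*) where
  support : Finset (Fin n)
  nonempty : support.Nonempty
  color : support → G

namespace ColoredSet

variable {n : ℕ} {G : Type*} [Group G]

/-- Two colored sets are equivalent if they have the same underlying set `B` and their colorings
satisfy `b = b' g` for some `g ∈ G`. -/
def Equivalent (a b : ColoredSet n G) : Prop :=
  a.support = b.support ∧
    ∃ g : G, ∀ (i : Fin n) (ha : i ∈ a.support) (hb : i ∈ b.support),
      a.color ⟨i, ha⟩ = b.color ⟨i, hb⟩ * g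

instance setoid (n : ℕ) (G : Type*) [Group G] : Setoid (ColoredSet n G) where
  r := Equivalent
  iseqv := by
    refine ⟨fun a => ⟨rfl, 1, by simp⟩, ?_, ?_⟩
    · rintro a b ⟨h, g, hg⟩
      exact ⟨h.symm, g⁻¹, fun i hb ha => by rw [hg i ha hb]; simp⟩
    · rintro a b c ⟨h, g, hg⟩ ⟨h', g', hg'⟩
      refine ⟨h.trans h', g' * g, fun i ha hc => ?_⟩
      have hb : i ∈ b.support := h ▸ ha
      rw [hg i ha hb, hg' i hb hc, mul_assoc]

/-- The one-element set `{i}`, colored by `g`. -/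
def single (i : Fin n) (g : G) : ColoredSet n G := ⟨{i}, by simp, fun _ => g⟩

end ColoredSet

/-- A block `B̃ = (B, b̄)`: a nonempty set `B ⊆ [n]` with a class `b̄` of functions `B → G`
modulo `b ∼ b g`. -/
def Block (n : ℕ) (G : Type*) [Group G] : Type _ := Quotient (ColoredSet.setoid n G)

namespace Block

variable {n : ℕ} {G : Type*} [Group G]

/-- The block represented by a colored set. -/
def mk (b : ColoredSet n G) : Block n G := Quotient.mk (ColoredSet.setoid n G) b

/-- The underlying subset of a block. -/
def support (B : Block n G) : Finset (Fin n) :=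
  Quotient.lift (s := ColoredSet.setoid n G) ColoredSet.support
    (fun a b (h : a.Equivalent b) => h.1) B

@[simp] theorem support_mk (b : ColoredSet n G) : (mk b).support = b.support := rfl

theorem exists_mk (B : Block n G) : ∃ b : ColoredSet n G, mk b = B := Quotient.exists_rep B

theorem nonempty (B : Block n G) : B.support.Nonempty := by
  obtain ⟨b, rfl⟩ := B.exists_mk
  exact b.nonempty

theorem mk_eq_mk {a b : ColoredSet n G} : mk a = mk b ↔ a.Equivalent b := Quotient.eq

instance [Finite G] : Finite (ColoredSet n G) :=
  Finite.of_injective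
    (β := Σ s : Finset (Fin n), (s → G)) (fun b => ⟨b.support, b.color⟩) (by
      rintro ⟨s, hs, c⟩ ⟨s', hs', c'⟩ h
      simp only [Sigma.mk.injEq] at h
      obtain ⟨rfl, h⟩ := h
      simp [eq_of_heq h])

instance [Finite G] : Finite (Block n G) :=
  inferInstanceAs (Finite (Quotient (ColoredSet.setoid n G)))

end Block

/-! ### The `S`-Dowling poset -/

/-- Elements of the `S`-Dowling poset: a partial `G`-partition of `[n]`, given by a finite set of
pairwise disjoint blocks, and an `S`-coloring `z : Z → S` of its zero block `Z`, which is the set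
of the elements that lie in no block. The function `z` is encoded as a partial function on `[n]`
with domain `Z` (the value `none` means "not in `Z`"). -/
@[ext]
structure DowlingPoset (n : ℕ) (G S : Type*) [Group G] where
  blocks : Finset (Block n G)
  disjoint : ∀ A ∈ blocks, ∀ B ∈ blocks, A ≠ B → Disjoint A.support B.support
  zeroColor : Fin n → Option S
  zeroColor_eq_none : ∀ i, zeroColor i = none ↔ ∃ B ∈ blocks, i ∈ B.support

namespace DowlingPoset

variable {n : ℕ} {G S : Type*} [Group G]

open Classical in
/-- `y` is obtained from `x` by replacing two blocks `Ã`, `B̃` by a block `C̃` with `C = A ∪ B` and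
`c = a ∪ b g` for some `g ∈ G`. -/
def Merge (x y : DowlingPoset n G S) : Prop :=
  ∃ (a b c : ColoredSet n G) (g : G),
    Block.mk a ∈ x.blocks ∧ Block.mk b ∈ x.blocks ∧ Block.mk a ≠ Block.mk b ∧
    c.support = a.support ∪ b.support ∧
    (∀ (i : Fin n) (hc : i ∈ c.support) (ha : i ∈ a.support),
      c.color ⟨i, hc⟩ = a.color ⟨i, ha⟩) ∧
    (∀ (i : Fin n) (hc : i ∈ c.support) (hb : i ∈ b.support),
      c.color ⟨i, hc⟩ = b.color ⟨i, hb⟩ * g) ∧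
    y.blocks = insert (Block.mk c) (x.blocks \ {Block.mk a, Block.mk b}) ∧
    y.zeroColor = x.zeroColor

open Classical in
/-- `y` is obtained from `x` by moving a block `B̃` into the zero block, where it is colored by
`i ↦ b(i) • s` for some `s ∈ S`. -/
def Color [MulAction G S] (x y : DowlingPoset n G S) : Prop :=
  ∃ (b : ColoredSet n G) (s : S),
    Block.mk b ∈ x.blocks ∧
    y.blocks = x.blocks \ {Block.mk b} ∧
    (∀ (i : Fin n) (hb : i ∈ b.support), y.zeroColor i = some (b.color ⟨i, hb⟩ • s)) ∧
    (∀ i : Fin n, i ∉ b.support → y.zeroColor i = x.zeroColor i)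

theorem Merge.card_lt {x y : DowlingPoset n G S} (h : Merge x y) :
    y.blocks.card < x.blocks.card := by
  classical
  obtain ⟨a, b, c, g, ha, hb, hab, -, -, -, hy, -⟩ := h
  have hsub : ({Block.mk a, Block.mk b} : Finset (Block n G)) ⊆ x.blocks := by
    simp [Finset.insert_subset_iff, ha, hb]
  have h2 : ({Block.mk a, Block.mk b} : Finset (Block n G)).card = 2 := Finset.card_pair hab
  have h3 := Finset.card_le_card hsub
  have h4 : (x.blocks \ {Block.mk a, Block.mk b}).card = x.blocks.card - 2 := by
    rw [Finset.card_sdiff_of_subset hsub, h2]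
  have h5 : y.blocks.card ≤ (x.blocks \ {Block.mk a, Block.mk b}).card + 1 := by
    rw [hy]
    convert Finset.card_insert_le (Block.mk c) (x.blocks \ {Block.mk a, Block.mk b})
  omega

/-- The element `0̂`: all blocks are singletons, and the zero block is empty. -/
instance : Bot (DowlingPoset n G S) where
  bot :=
    { blocks := Finset.univ.map ⟨fun i : Fin n => Block.mk (ColoredSet.single i (1 : G)), by
        intro i j h
        have h' := congrArg Block.support h
        simpa [ColoredSet.single] using h'⟩
      disjoint := by
        intro A hA B hB hAB
        simp only [Finset.mem_map, Finset.mem_univ, true_and]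
          at hA hB
        obtain ⟨i, rfl⟩ := hA
        obtain ⟨j, rfl⟩ := hB
        have hij : i ≠ j := fun h => hAB (by rw [h])
        simpa [ColoredSet.single] using hij
      zeroColor := fun _ => none
      zeroColor_eq_none := by
        intro i
        simp [ColoredSet.single] }

theorem mem_blocks_bot {B : Block n G} :
    B ∈ (⊥ : DowlingPoset n G S).blocks ↔
      ∃ i : Fin n, Block.mk (ColoredSet.single i (1 : G)) = B := by
  change B ∈ Finset.map _ _ ↔ _
  simp only [Finset.mem_map, Finset.mem_univ, true_and]
  rfl

theorem zeroColor_bot (i : Fin n) : (⊥ : DowlingPoset n G S).zeroColor i = none := rfl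

theorem card_blocks_le (x : DowlingPoset n G S) : x.blocks.card ≤ n := by
  classical
  have h : ∀ B : Block n G, ∃ i, i ∈ B.support := fun B => B.nonempty
  choose f hf using h
  have := Finset.card_le_card_of_injOn (s := x.blocks) (t := Finset.univ) f (by simp) (by
    intro A hA B hB hAB
    by_contra hne
    exact Finset.disjoint_left.mp (x.disjoint A hA B hB hne) (hf A) (hAB ▸ hf B))
  simpa using this

theorem eq_bot_of_forall {x : DowlingPoset n G S} (hz : ∀ i, x.zeroColor i = none)
    (hb : ∀ B ∈ x.blocks, ∀ i ∈ B.support, ∀ j ∈ B.support, i = j) : x = ⊥ := by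
  have key : ∀ B ∈ x.blocks, ∀ i ∈ B.support,
      B = Block.mk (ColoredSet.single i (1 : G)) := by
    intro B hB i hi
    have h := hb B hB
    obtain ⟨b, rfl⟩ := B.exists_mk
    rw [Block.mk_eq_mk]
    have hs : b.support = {i} := by
      ext j
      simp only [Finset.mem_singleton]
      exact ⟨fun hj => h j hj i hi, fun hj => hj ▸ hi⟩
    refine ⟨hs, b.color ⟨i, hi⟩, fun j hj _ => ?_⟩
    have : j = i := h j hj i hi
    subst this
    simp [ColoredSet.single]
  apply DowlingPoset.ext
  · ext B
    rw [mem_blocks_bot]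
    constructor
    · intro hB
      obtain ⟨i, hi⟩ := B.nonempty
      exact ⟨i, (key B hB i hi).symm⟩
    · rintro ⟨i, rfl⟩
      obtain ⟨B, hB, hi⟩ := (x.zeroColor_eq_none i).mp (hz i)
      exact key B hB i hi ▸ hB
  · funext i
    exact hz i

variable [MulAction G S]

theorem Color.card_lt {x y : DowlingPoset n G S} (h : Color x y) :
    y.blocks.card < x.blocks.card := by
  classical
  obtain ⟨b, s, hb, hy, -⟩ := h
  have h1 : y.blocks = x.blocks.erase (Block.mk b) := by
    rw [hy]; ext; simp [and_comm]
  rw [h1]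
  exact Finset.card_erase_lt_of_mem hb

/-- The elementary relations that generate the order. -/
def Step (x y : DowlingPoset n G S) : Prop := Merge x y ∨ Color x y

theorem Step.card_lt {x y : DowlingPoset n G S} (h : Step x y) :
    y.blocks.card < x.blocks.card :=
  h.elim Merge.card_lt Color.card_lt

theorem eq_or_card_lt {x y : DowlingPoset n G S} (h : Relation.ReflTransGen Step x y) :
    x = y ∨ y.blocks.card < x.blocks.card := by
  induction h with
  | refl => exact Or.inl rfl
  | tail _ h ih =>
    rcases ih with rfl | ih
    · exact Or.inr h.card_lt
    · exact Or.inr (h.card_lt.trans ih)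

/-- The order generated by the steps of type "merge" and "color". -/
instance : PartialOrder (DowlingPoset n G S) where
  le := Relation.ReflTransGen Step
  le_refl _ := .refl
  le_trans _ _ _ := .trans
  le_antisymm x y hxy hyx := by
    rcases eq_or_card_lt hxy with h | h
    · exact h
    · rcases eq_or_card_lt hyx with h' | h'
      · exact h'.symm
      · omega

theorem exists_step_of_ne_bot {x : DowlingPoset n G S} (hx : x ≠ ⊥) :
    ∃ y : DowlingPoset n G S, Step y x := by
  classical
  by_cases hz : ∀ i, x.zeroColor i = none
  · by_cases hb : ∀ B ∈ x.blocks, ∀ i ∈ B.support, ∀ j ∈ B.support, i = j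
    · exact absurd (eq_bot_of_forall hz hb) hx
    · push Not at hb
      obtain ⟨B, hB, i, hi, j, hj, hij⟩ := hb
      obtain ⟨b, rfl⟩ := B.exists_mk
      rw [Block.support_mk] at hi hj
      let a : ColoredSet n G := ColoredSet.single i (b.color ⟨i, hi⟩)
      let c : ColoredSet n G := ⟨b.support.erase i, ⟨j, by simp [hj, Ne.symm hij]⟩,
        fun k => b.color ⟨k, Finset.mem_of_mem_erase k.2⟩⟩
      have hsa : a.support = {i} := rfl
      have hsc : c.support = b.support.erase i := rfl
      have hac : Disjoint a.support c.support := by simp [hsa, hsc]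
      have hne : Block.mk a ≠ Block.mk c := by
        intro h
        have h' := congrArg Block.support h
        simp only [Block.support_mk] at h'
        have : i ∈ c.support := by rw [← h', hsa]; simp
        simp [hsc] at this
      have hun : b.support = a.support ∪ c.support := by
        rw [hsa, hsc]; ext k; by_cases hk : k = i <;> simp [hk, hi]
      have hold : ∀ A ∈ x.blocks, A ≠ Block.mk b →
          Disjoint A.support a.support ∧ Disjoint A.support c.support := by
        intro A hA hAb
        have := x.disjoint A hA _ hB hAb
        rw [Block.support_mk, hun, Finset.disjoint_union_right] at this
        exact this
      have hna : Block.mk a ∉ x.blocks \ {Block.mk b} := by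
        intro h
        simp only [Finset.mem_sdiff, Finset.mem_singleton] at h
        have := (hold _ h.1 h.2).1
        rw [Block.support_mk, disjoint_self] at this
        exact a.nonempty.ne_empty this
      have hnc : Block.mk c ∉ x.blocks \ {Block.mk b} := by
        intro h
        simp only [Finset.mem_sdiff, Finset.mem_singleton] at h
        have := (hold _ h.1 h.2).2
        rw [Block.support_mk, disjoint_self] at this
        exact c.nonempty.ne_empty this
      refine ⟨⟨insert (Block.mk a) (insert (Block.mk c) (x.blocks \ {Block.mk b})), ?_,
        x.zeroColor, ?_⟩, Or.inl ⟨a, c, b, 1, by simp, by simp, hne, hun, ?_, ?_, ?_, rfl⟩⟩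
      · intro A hA C hC hAC
        simp only [Finset.mem_insert, Finset.mem_sdiff, Finset.mem_singleton] at hA hC
        rcases hA with rfl | rfl | hA <;> rcases hC with rfl | rfl | hC
        · exact absurd rfl hAC
        · exact hac
        · exact (hold C hC.1 hC.2).1.symm
        · exact hac.symm
        · exact absurd rfl hAC
        · exact (hold C hC.1 hC.2).2.symm
        · exact (hold A hA.1 hA.2).1
        · exact (hold A hA.1 hA.2).2
        · exact x.disjoint A hA.1 C hC.1 hAC
      · intro k
        rw [x.zeroColor_eq_none k]
        constructor
        · rintro ⟨A, hA, hk⟩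
          by_cases hAb : A = Block.mk b
          · subst hAb
            rw [Block.support_mk, hun, Finset.mem_union] at hk
            rcases hk with hk | hk
            · exact ⟨Block.mk a, by simp, hk⟩
            · exact ⟨Block.mk c, by simp, hk⟩
          · exact ⟨A, by simp [hA, hAb], hk⟩
        · rintro ⟨A, hA, hk⟩
          simp only [Finset.mem_insert, Finset.mem_sdiff, Finset.mem_singleton] at hA
          rcases hA with rfl | rfl | hA
          · exact ⟨Block.mk b, hB, by
              rw [Block.support_mk, hun]; exact Finset.mem_union_left _ hk⟩
          · exact ⟨Block.mk b, hB, by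
              rw [Block.support_mk, hun]; exact Finset.mem_union_right _ hk⟩
          · exact ⟨A, hA.1, hk⟩
      · intro k hk hka
        have : k = i := by simpa [hsa] using hka
        subst this
        rfl
      · intro k hk hkc
        rw [mul_one]
      · ext A
        simp only [Finset.mem_insert, Finset.mem_sdiff, Finset.mem_singleton]
        constructor
        · intro hA
          by_cases hAb : A = Block.mk b
          · exact Or.inl hAb
          · refine Or.inr ⟨Or.inr (Or.inr ⟨hA, hAb⟩), ?_⟩
            rintro (rfl | rfl)
            · exact hna (by simp [hA, hAb])
            · exact hnc (by simp [hA, hAb])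
        · rintro (rfl | ⟨rfl | rfl | hA, h⟩)
          · exact hB
          · exact absurd (Or.inl rfl) h
          · exact absurd (Or.inr rfl) h
          · exact hA.1
  · push Not at hz
    obtain ⟨i, hi⟩ := hz
    obtain ⟨s, hs⟩ := Option.ne_none_iff_exists'.mp hi
    let a : ColoredSet n G := ColoredSet.single i 1
    have hsa : (Block.mk a).support = {i} := rfl
    have hni : ∀ A ∈ x.blocks, i ∉ A.support := fun A hA h =>
      hi ((x.zeroColor_eq_none i).mpr ⟨A, hA, h⟩)
    have hna : Block.mk a ∉ x.blocks := fun h => hni _ h (by simp [hsa])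
    refine ⟨⟨insert (Block.mk a) x.blocks, ?_, fun k => if k = i then none else x.zeroColor k, ?_⟩,
      Or.inr ⟨a, s, by simp, ?_, ?_, ?_⟩⟩
    · intro A hA C hC hAC
      simp only [Finset.mem_insert] at hA hC
      rcases hA with rfl | hA <;> rcases hC with rfl | hC
      · exact absurd rfl hAC
      · simpa [hsa] using hni C hC
      · simpa [hsa] using hni A hA
      · exact x.disjoint A hA C hC hAC
    · intro k
      by_cases hk : k = i
      · subst hk
        simp only [if_true, true_iff]
        exact ⟨Block.mk a, by simp, by simp [hsa]⟩
      · simp only [hk, if_false, Finset.mem_insert, exists_eq_or_imp, hsa, Finset.mem_singleton,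
          false_or]
        exact x.zeroColor_eq_none k
    · ext A
      simp only [Finset.mem_sdiff, Finset.mem_insert, Finset.mem_singleton]
      constructor
      · intro hA
        exact ⟨Or.inr hA, fun h => hna (h ▸ hA)⟩
      · rintro ⟨h | h, h'⟩
        · exact absurd h h'
        · exact h
    · intro k hk
      have : k = i := by simpa [a, ColoredSet.single] using hk
      subst this
      simpa [a, ColoredSet.single] using hs
    · intro k hk
      have : k ≠ i := by simpa [a, ColoredSet.single] using hk
      simp [this]

/-- The element `0̂` is the least element. -/
instance : OrderBot (DowlingPoset n G S) where
  bot_le x := by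
    change Relation.ReflTransGen Step ⊥ x
    induction h : n - x.blocks.card using Nat.strong_induction_on generalizing x with
    | _ m ih =>
      by_cases hx : x = ⊥
      · rw [hx]
      · obtain ⟨y, hy⟩ := exists_step_of_ne_bot hx
        have h1 := hy.card_lt
        have h2 := y.card_blocks_le
        exact (ih _ (by omega) y rfl).tail hy

instance [Finite G] [Finite S] : Finite (DowlingPoset n G S) :=
  Finite.of_injective (β := Finset (Block n G) × (Fin n → Option S))
    (fun x => (x.blocks, x.zeroColor)) (by
      intro x y h
      simp only [Prod.mk.injEq] at h
      exact DowlingPoset.ext h.1 h.2)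

end DowlingPoset

/-! ### The subposets -/

/-- The subposet `P_n(G,S,T)` of the Dowling poset, for a `G`-invariant subset `T ⊆ S`:
the elements with `|z⁻¹(O)| ≠ 1` for every `G`-orbit `O ⊆ S \ T`. -/
def subposet (n : ℕ) (G : Type*) {S : Type*} [Group G] [MulAction G S] (T : Set S) :
    Set (DowlingPoset n G S) :=
  {x | ∀ s : S, MulAction.orbit G s ⊆ Tᶜ →
    {i : Fin n | ∃ t ∈ MulAction.orbit G s, x.zeroColor i = some t}.ncard ≠ 1}

/-- The poset `P_n(G,S,T) \ {0̂}`, with the order induced by the Dowling poset. -/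
abbrev SubposetBar (n : ℕ) (G : Type*) {S : Type*} [Group G] [MulAction G S] (T : Set S) :
    Type _ :=
  {x : DowlingPoset n G S // x ∈ subposet n G T ∧ x ≠ ⊥}

/-! ### Order complexes and their geometric realizations -/

/-- The order complex of a poset: the abstract simplicial complex of its nonempty finite chains. -/
def orderComplex (P : Type*) [PartialOrder P] : AbstractSimplicialComplex P where
  faces := {σ | σ.Nonempty ∧ IsChain (· ≤ ·) (σ : Set P)}
  isRelLowerSet_faces := fun _ hσ =>
    ⟨hσ.1, fun _ hτ hne => ⟨hne, hσ.2.mono (Finset.coe_subset.mpr hτ)⟩⟩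
  singleton_mem v := ⟨Finset.singleton_nonempty v, by simp⟩

/-- The geometric realization of a finite abstract simplicial complex: the barycentric coordinates
supported on some face, with the topology of a subspace of `ℝ^V`. -/
abbrev GeometricRealization {V : Type*} [Finite V] (K : AbstractSimplicialComplex V) : Type _ :=
  {w : V → ℝ // ∃ σ ∈ K.faces,
    (∀ v, 0 ≤ w v) ∧ (∀ v, v ∉ σ → w v = 0) ∧ ∑ v ∈ σ, w v = 1}

/-- Two finite posets are homotopy equivalent if (the geometric realizations of) their order
complexes are homotopy equivalent. -/
def PosetHomotopyEquivalent (P Q : Type*) [PartialOrder P] [PartialOrder Q] [Finite P] [Finite Q] :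
    Prop :=
  Nonempty (ContinuousMap.HomotopyEquiv
    (GeometricRealization (orderComplex P)) (GeometricRealization (orderComplex Q)))

end

noncomputable section

/-! ### Realizations of order complexes -/

section Realization

/-! The trivial stabilizer makes the colors in `O` equivalent to group elements. After fixing `s₀ ∈
O`, each color in `O` is `g • s₀` for exactly one `g`. The zero block elements with colors in `O`
therefore carry a `G`-coloring and can be taken out of the zero block as one new block. This is
`orbitToBlock`, a map to the poset with colors in `S \ O`. In the other direction there is
`inclusion`.

Both maps are monotone; for `orbitToBlock` the real case is a color step (`Color.orbitToBlock_le`).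
Applying `inclusion` and then `orbitToBlock` gives the identity, since no color lies in `O`.
Applying them in the other order gives an element below `x`, since coloring the new block by `s₀`
recovers `x` (`inclusion_orbitToBlock_le`). The condition `|z⁻¹(O)| ≠ 1` prevents `orbitToBlock`
from sending an element other than `0̂` to `0̂` (`orbitToBlock_ne_bot`).

It remains to see that a monotone self-map `h ≤ id` of a finite poset is homotopic to the identity
on realizations. A point is a weight of total mass 1 on a chain; at time `t` the lowest mass `t` has
been moved along `h`. Moved points lie below unmoved ones, so the support remains a chain. -/

open Classical in
theorem mem_realization_iff {P : Type*} [PartialOrder P] [Fintype P] {w : P → ℝ} :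
    (∃ σ ∈ (orderComplex P).faces,
      (∀ v, 0 ≤ w v) ∧ (∀ v, v ∉ σ → w v = 0) ∧ ∑ v ∈ σ, w v = 1) ↔
    (∀ v, 0 ≤ w v) ∧ ∑ v, w v = 1 ∧ IsChain (· ≤ ·) (Function.support w) := by
  constructor
  · rintro ⟨σ, hσ, h0, hz, h1⟩
    refine ⟨h0, ?_, hσ.2.mono fun v hv => ?_⟩
    · rw [← h1]
      exact (Finset.sum_subset (Finset.subset_univ σ) fun v _ hv => hz v hv).symm
    · by_contra h
      exact hv (hz v h)
  · rintro ⟨h0, h1, hc⟩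
    have hsum : ∑ v ∈ Finset.univ.filter (fun v => w v ≠ 0), w v = 1 := by
      rw [Finset.sum_filter_ne_zero, h1]
    refine ⟨Finset.univ.filter (fun v => w v ≠ 0), ⟨?_, ?_⟩, h0, ?_, hsum⟩
    · rw [Finset.nonempty_iff_ne_empty]
      intro h
      rw [h] at hsum
      simp at hsum
    · simpa [Function.support] using hc
    · intro v hv
      simpa using hv

open Classical in
/-- The push-forward of a weight function along a map. -/
def pushWeight {P Q : Type*} [Fintype P] (f : P → Q) (w : P → ℝ) (q : Q) : ℝ :=
  ∑ p, if f p = q then w p else 0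

variable {P Q : Type*} [Fintype P]

theorem pushWeight_nonneg {f : P → Q} {w : P → ℝ} (h : ∀ p, 0 ≤ w p) (q : Q) :
    0 ≤ pushWeight f w q :=
  Finset.sum_nonneg fun p _ => by split_ifs <;> simp [h]

theorem sum_pushWeight [Fintype Q] (f : P → Q) (w : P → ℝ) : ∑ q, pushWeight f w q = ∑ p, w p := by
  classical
  unfold pushWeight
  rw [Finset.sum_comm]
  simp

theorem exists_of_pushWeight_ne_zero {f : P → Q} {w : P → ℝ} {q : Q}
    (h : pushWeight f w q ≠ 0) : ∃ p, f p = q ∧ w p ≠ 0 := by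
  obtain ⟨p, -, hp⟩ := Finset.exists_ne_zero_of_sum_ne_zero h
  by_cases hq : f p = q
  · exact ⟨p, hq, by simpa [hq] using hp⟩
  · simp [hq] at hp

theorem pushWeight_id (w : P → ℝ) : pushWeight id w = w := by
  classical
  funext q
  simp [pushWeight]

/-- Functoriality: it identifies the composite of two induced maps with the map induced by the
composite. -/
theorem pushWeight_comp [Fintype Q] {R : Type*} (f : P → Q) (g : Q → R) (w : P → ℝ) :
    pushWeight g (pushWeight f w) = pushWeight (g ∘ f) w := by
  classical
  funext r
  have h : ∀ q, (if g q = r then pushWeight f w q else 0) =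
      ∑ p, if f p = q then (if g q = r then w p else 0) else 0 := by
    intro q
    split_ifs <;> simp [pushWeight]
  rw [pushWeight, Finset.sum_congr rfl fun q _ => h q, Finset.sum_comm]
  simp [pushWeight]

theorem continuous_pushWeight (f : P → Q) : Continuous (pushWeight f) := by
  classical
  refine continuous_pi fun q => continuous_finsetSum _ fun p _ => ?_
  split_ifs
  · exact continuous_apply p
  · exact continuous_const

variable [PartialOrder P]

theorem pushWeight_mem [PartialOrder Q] [Fintype Q] (f : P →o Q) {w : P → ℝ}
    (hw : ∃ σ ∈ (orderComplex P).faces,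
      (∀ v, 0 ≤ w v) ∧ (∀ v, v ∉ σ → w v = 0) ∧ ∑ v ∈ σ, w v = 1) :
    ∃ σ ∈ (orderComplex Q).faces, (∀ v, 0 ≤ pushWeight f w v) ∧
      (∀ v, v ∉ σ → pushWeight f w v = 0) ∧ ∑ v ∈ σ, pushWeight f w v = 1 := by
  obtain ⟨h0, h1, hc⟩ := mem_realization_iff.mp hw
  refine mem_realization_iff.mpr ⟨pushWeight_nonneg h0, (sum_pushWeight f w).trans h1, ?_⟩
  intro q hq q' hq' _
  obtain ⟨p, rfl, hp⟩ := exists_of_pushWeight_ne_zero hq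
  obtain ⟨p', rfl, hp'⟩ := exists_of_pushWeight_ne_zero hq'
  exact (hc.total hp hp').imp (fun h => f.monotone h) (fun h => f.monotone h)

/-- The map of realizations induced by a monotone map. -/
def realizationMap [PartialOrder Q] [Fintype Q] (f : P →o Q) :
    C(GeometricRealization (orderComplex P), GeometricRealization (orderComplex Q)) where
  toFun w := ⟨pushWeight f w.1, pushWeight_mem f w.2⟩
  continuous_toFun :=
    ((continuous_pushWeight f).comp continuous_subtype_val).subtype_mk _

/-! ### Homotopy from the identity to a decreasing map -/

open Classical in
/-- The part of the weight of `p` that lies in the lowest `t` of the total weight. -/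
def lowerWeight (t : ℝ) (w : P → ℝ) (p : P) : ℝ :=
  min (w p) (max 0 (t - ∑ q, if q < p then w q else 0))

theorem continuous_lowerWeight :
    Continuous fun x : ℝ × (P → ℝ) => lowerWeight x.1 x.2 := by
  classical
  refine continuous_pi fun p => ?_
  have h : Continuous fun x : ℝ × (P → ℝ) => ∑ q, if q < p then x.2 q else 0 := by
    refine continuous_finsetSum _ fun q _ => ?_
    split_ifs
    · exact (continuous_apply q).comp continuous_snd
    · exact continuous_const
  exact ((continuous_apply p).comp continuous_snd).min
    (continuous_const.max (continuous_fst.sub h))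

theorem lowerWeight_nonneg {t : ℝ} {w : P → ℝ} (h : ∀ p, 0 ≤ w p) (p : P) :
    0 ≤ lowerWeight t w p :=
  le_min (h p) (le_max_left _ _)

theorem lowerWeight_le (t : ℝ) (w : P → ℝ) (p : P) : lowerWeight t w p ≤ w p :=
  min_le_left _ _

theorem lowerWeight_zero {w : P → ℝ} (h : ∀ p, 0 ≤ w p) : lowerWeight 0 w = 0 := by
  classical
  funext p
  have : 0 ≤ ∑ q, if q < p then w q else 0 :=
    Finset.sum_nonneg fun q _ => by split_ifs <;> simp [h]
  simp [lowerWeight, this, h]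

-- The mass strictly below `p` and the mass at `p` are disjoint parts of the mass of `s`. The case
-- of the whole poset shows that everything has moved at time 1; the case of a strict lower set
-- compares two points of a chain.
open Classical in
theorem sum_lt_add_le {w : P → ℝ} (h : ∀ p, 0 ≤ w p) (p : P) (s : Set P)
    (hs : ∀ q, q ≤ p → q ∈ s) :
    (∑ q, if q < p then w q else 0) + w p ≤ ∑ q, if q ∈ s then w q else 0 := by
  have hp : w p = ∑ q, if q = p then w q else 0 := by simp
  rw [hp, ← Finset.sum_add_distrib]
  refine Finset.sum_le_sum fun q _ => ?_
  by_cases hq : q = p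
  · subst hq
    simp [hs q le_rfl]
  · by_cases hlt : q < p
    · simp [hlt, hq, hs q hlt.le]
    · simp only [hlt, hq, if_false, add_zero]
      split_ifs <;> simp [h]

theorem lowerWeight_one {w : P → ℝ} (h : ∀ p, 0 ≤ w p) (h1 : ∑ p, w p = 1) :
    lowerWeight 1 w = w := by
  classical
  funext p
  have := sum_lt_add_le h p Set.univ fun _ _ => trivial
  simp only [Set.mem_univ, if_true, h1] at this
  exact min_eq_left (le_max_of_le_right (by linarith))

/-- The mass is taken from the bottom of the chain upwards, so a point is reached only after every
support point below it is used up. This is what keeps the moved and unmoved parts comparable. -/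
theorem le_of_lowerWeight {t : ℝ} {w : P → ℝ} (h : ∀ p, 0 ≤ w p)
    (hc : IsChain (· ≤ ·) (Function.support w)) {p q : P} (hp : lowerWeight t w p ≠ 0)
    (hq : lowerWeight t w q ≠ w q) : p ≤ q := by
  classical
  have hwp : w p ≠ 0 := fun h' =>
    hp (le_antisymm (h' ▸ lowerWeight_le t w p) (lowerWeight_nonneg h p))
  have hwq : w q ≠ 0 := fun h' =>
    hq (le_antisymm (lowerWeight_le t w q) (h' ▸ lowerWeight_nonneg h q))
  rcases hc.total hwp hwq with hle | hle
  · exact hle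
  rcases hle.eq_or_lt with rfl | hlt
  · exact le_rfl
  exfalso
  have h2 := sum_lt_add_le h q {r | r < p} fun r hr => hr.trans_lt hlt
  simp only [Set.mem_ofPred_eq] at h2
  -- Some mass of `p` is taken, so `t` exceeds the mass strictly below `p`. By `h2` that mass
  -- includes everything below `q` and all of `q`, so `q` would be used up.
  have h3 : 0 < t - ∑ r, if r < p then w r else 0 := by
    by_contra h'
    exact hp (by rw [lowerWeight, max_eq_left (not_lt.mp h'), min_eq_right (h p)])
  exact hq (min_eq_left (le_max_of_le_right (by linarith)))

/-- The homotopy that moves the weight along a decreasing map, starting with the lowest part. -/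
def lowerHomotopyFun (h : P → P) (t : ℝ) (w : P → ℝ) : P → ℝ :=
  w - lowerWeight t w + pushWeight h (lowerWeight t w)

theorem lowerHomotopyFun_mem {h : P →o P} (hle : ∀ p, h p ≤ p) (t : ℝ)
    (w : GeometricRealization (orderComplex P)) :
    ∃ σ ∈ (orderComplex P).faces, (∀ v, 0 ≤ lowerHomotopyFun h t w.1 v) ∧
      (∀ v, v ∉ σ → lowerHomotopyFun h t w.1 v = 0) ∧
      ∑ v ∈ σ, lowerHomotopyFun h t w.1 v = 1 := by
  obtain ⟨w, hw⟩ := w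
  obtain ⟨h0, h1, hc⟩ := mem_realization_iff.mp hw
  have hl := lowerWeight_nonneg (t := t) h0
  refine mem_realization_iff.mpr ⟨fun v => ?_, ?_, ?_⟩
  · exact add_nonneg (sub_nonneg.mpr (lowerWeight_le t w v)) (pushWeight_nonneg hl v)
  · simp [lowerHomotopyFun, Finset.sum_add_distrib, Finset.sum_sub_distrib, sum_pushWeight, h1]
  · have key : ∀ v, lowerHomotopyFun h t w v ≠ 0 →
        lowerWeight t w v ≠ w v ∨ ∃ p, h p = v ∧ lowerWeight t w p ≠ 0 := by
      intro v hv
      by_contra! hcon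
      obtain ⟨ha, hb⟩ := hcon
      refine hv ?_
      have : pushWeight h (lowerWeight t w) v = 0 := by
        by_contra h'
        obtain ⟨p, hp, hp'⟩ := exists_of_pushWeight_ne_zero h'
        exact hp' (hb p hp)
      simp [lowerHomotopyFun, ha, this]
    have hsl : ∀ p, lowerWeight t w p ≠ 0 → w p ≠ 0 := fun p hp h' =>
      hp (le_antisymm (h' ▸ lowerWeight_le t w p) (hl p))
    have hsu : ∀ p, lowerWeight t w p ≠ w p → w p ≠ 0 := fun p hp h' =>
      hp (le_antisymm (lowerWeight_le t w p) (h' ▸ hl p))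
    intro v hv v' hv' _
    -- Two unmoved points, or two images of moved points, are comparable because the support of `w`
    -- is a chain. In the mixed cases, a moved `p` and an unmoved `v` satisfy `h p ≤ p ≤ v`.
    rcases key v hv with ha | ⟨p, rfl, hp⟩ <;> rcases key v' hv' with ha' | ⟨p', rfl, hp'⟩
    · exact hc.total (hsu _ ha) (hsu _ ha')
    · exact Or.inr ((hle p').trans (le_of_lowerWeight h0 hc hp' ha))
    · exact Or.inl ((hle p).trans (le_of_lowerWeight h0 hc hp ha'))
    · exact (hc.total (hsl _ hp) (hsl _ hp')).imp (fun e => h.monotone e) (fun e => h.monotone e)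

/-- A decreasing monotone self-map of a finite poset induces a map homotopic to the identity. -/
theorem realizationMap_homotopic_id {h : P →o P} (hle : ∀ p, h p ≤ p) :
    (realizationMap h).Homotopic (ContinuousMap.id _) := by
  -- The homotopy is the identity at time 0 and the map induced by `h` at time 1, hence the
  -- symmetry.
  refine ContinuousMap.Homotopic.symm ⟨⟨⟨fun x =>
    ⟨lowerHomotopyFun h (x.1 : ℝ) x.2.1, lowerHomotopyFun_mem hle x.1 x.2⟩, ?_⟩, ?_, ?_⟩⟩
  · have h1 : Continuous fun x : unitInterval × GeometricRealization (orderComplex P) =>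
        ((x.1 : ℝ), x.2.1) := by fun_prop
    have h2 := continuous_lowerWeight.comp h1
    exact (((continuous_snd.comp h1).sub h2).add
      ((continuous_pushWeight h).comp h2)).subtype_mk _
  · intro w
    obtain ⟨h0, -, -⟩ := mem_realization_iff.mp w.2
    refine Subtype.ext ?_
    funext v
    simp [lowerHomotopyFun, lowerWeight_zero h0, pushWeight]
  · intro w
    obtain ⟨h0, h1, -⟩ := mem_realization_iff.mp w.2
    refine Subtype.ext ?_
    simp [lowerHomotopyFun, lowerWeight_one h0 h1, realizationMap]

end Realization

/-- Monotone maps `f`, `g` with `g ∘ f ≤ id` and `f ∘ g = id` are homotopy inverse. -/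
theorem PosetHomotopyEquivalent.of_le_id {P Q : Type*} [PartialOrder P] [PartialOrder Q]
    [Finite P] [Finite Q] (f : P →o Q) (g : Q →o P) (hgf : ∀ p, g (f p) ≤ p)
    (hfg : ∀ q, f (g q) = q) : PosetHomotopyEquivalent P Q := by
  have := Fintype.ofFinite P
  have := Fintype.ofFinite Q
  refine ⟨⟨realizationMap f, realizationMap g, ?_, ?_⟩⟩
  · have h : (realizationMap g).comp (realizationMap f) = realizationMap (g.comp f) := by
      ext w : 2
      exact pushWeight_comp _ _ _
    rw [h]
    exact realizationMap_homotopic_id hgf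
  · have h : (realizationMap f).comp (realizationMap g) = ContinuousMap.id _ := by
      ext w : 2
      refine (pushWeight_comp _ _ _).trans ?_
      have : (f ∘ g : Q → Q) = id := funext hfg
      rw [this, pushWeight_id]
      rfl
    rw [h]

/-! ### Moving a free orbit of zero block colors into a block -/

/-- `O` is the orbit of `s₀`, and the action of `G` on it is free. -/
structure IsFreeOrbit {G S : Type*} [Group G] [MulAction G S] (O : SubMulAction G S) (s₀ : S) :
    Prop where
  mem_iff : ∀ t, t ∈ O ↔ ∃ g : G, t = g • s₀
  smul_inj : ∀ g h : G, g • s₀ = h • s₀ → g = h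

namespace DowlingPoset

variable {n : ℕ} {G S : Type*} [Group G] [MulAction G S] {O : SubMulAction G S} {s₀ : S}

/-- The colored set `b` consists of the zero block elements of `x` that are colored by the orbit
of `s₀`, with `b(i) • s₀` the color of `i` in `x`. -/
def Represents (s₀ : S) (x : DowlingPoset n G S) (b : ColoredSet n G) : Prop :=
  (∀ (i : Fin n) (hi : i ∈ b.support), x.zeroColor i = some (b.color ⟨i, hi⟩ • s₀)) ∧
    ∀ (i : Fin n) (g : G), x.zeroColor i = some (g • s₀) → i ∈ b.support

theorem Represents.congr {x y : DowlingPoset n G S} {b : ColoredSet n G}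
    (h : ∀ (i : Fin n) (g : G), x.zeroColor i = some (g • s₀) ↔ y.zeroColor i = some (g • s₀)) :
    Represents s₀ x b ↔ Represents s₀ y b := by
  simp only [Represents, h]

/-- This is where freeness enters: `g • s₀` determines `g`, so there is at most one orbit block. -/
theorem Represents.mk_eq (hO : IsFreeOrbit O s₀) {x : DowlingPoset n G S} {a b : ColoredSet n G}
    (ha : Represents s₀ x a) (hb : Represents s₀ x b) : Block.mk a = Block.mk b := by
  refine Block.mk_eq_mk.mpr ⟨?_, 1, fun i hia hib => ?_⟩
  · ext i
    exact ⟨fun hi => hb.2 i _ (ha.1 i hi), fun hi => ha.2 i _ (hb.1 i hi)⟩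
  · rw [mul_one]
    exact hO.smul_inj _ _ (Option.some_injective _ ((ha.1 i hia).symm.trans (hb.1 i hib)))

theorem Represents.disjoint {x : DowlingPoset n G S} {a : ColoredSet n G}
    (ha : Represents s₀ x a) {B : Block n G} (hB : B ∈ x.blocks) :
    Disjoint B.support a.support := by
  refine Finset.disjoint_left.mpr fun i hi hia => ?_
  have h := (x.zeroColor_eq_none i).mpr ⟨B, hB, hi⟩
  rw [ha.1 i hia] at h
  cases h

theorem Represents.notMem {x : DowlingPoset n G S} {a : ColoredSet n G}
    (ha : Represents s₀ x a) : Block.mk a ∉ x.blocks := fun h =>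
  a.nonempty.ne_empty (disjoint_self.mp (ha.disjoint h))

open Classical in
theorem exists_represents {x : DowlingPoset n G S} {i : Fin n} {g : G}
    (h : x.zeroColor i = some (g • s₀)) : ∃ b, Represents s₀ x b := by
  have hmem : ∀ j : Fin n, j ∈ Finset.univ.filter
      (fun j => ∃ g : G, x.zeroColor j = some (g • s₀)) →
        ∃ g : G, x.zeroColor j = some (g • s₀) := by simp
  refine ⟨⟨Finset.univ.filter fun j => ∃ g : G, x.zeroColor j = some (g • s₀),
    ⟨i, by simpa using ⟨g, h⟩⟩, fun j => (hmem j.1 j.2).choose⟩, fun j hj => ?_, fun j g' hj => ?_⟩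
  · exact (hmem j hj).choose_spec
  · simpa using ⟨g', hj⟩

open Classical in
/-- The zero block elements of `x` with colors in the free orbit `O` form a block of
`orbitToBlock hO x`, and the other elements keep their blocks and colors. -/
def orbitToBlock [Finite G] (hO : IsFreeOrbit O s₀) (x : DowlingPoset n G S) :
    DowlingPoset n G ↥(Oᶜ) where
  -- The second alternative adds no block if `O` does not occur among the colors of `x`, because
  -- colored sets are nonempty, and exactly one block otherwise.
  blocks := (Set.toFinite {B | B ∈ x.blocks ∨ ∃ b, Represents s₀ x b ∧ B = Block.mk b}).toFinset
  disjoint := by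
    intro A hA B hB hAB
    simp only [Set.Finite.mem_toFinset, Set.mem_ofPred_eq] at hA hB
    rcases hA with hA | ⟨a, ha, rfl⟩ <;> rcases hB with hB | ⟨b, hb, rfl⟩
    · exact x.disjoint A hA B hB hAB
    · exact hb.disjoint hA
    · exact (ha.disjoint hB).symm
    · exact absurd (ha.mk_eq hO hb) hAB
  zeroColor i := (x.zeroColor i).bind fun s => if h : s ∈ Oᶜ then some ⟨s, h⟩ else none
  zeroColor_eq_none := by
    intro i
    simp only [Set.Finite.mem_toFinset, Set.mem_ofPred_eq]
    constructor
    · intro h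
      cases hx : x.zeroColor i with
      | none =>
        obtain ⟨B, hB, hi⟩ := (x.zeroColor_eq_none i).mp hx
        exact ⟨B, Or.inl hB, hi⟩
      | some s =>
        have hs : s ∈ O := by
          by_contra hs
          have hs' : s ∈ Oᶜ := hs
          simp [hx, hs'] at h
        obtain ⟨g, rfl⟩ := (hO.mem_iff s).mp hs
        obtain ⟨b, hb⟩ := exists_represents hx
        exact ⟨_, Or.inr ⟨b, hb, rfl⟩, hb.2 i g hx⟩
    · rintro ⟨B, hB | ⟨b, hb, rfl⟩, hi⟩
      · simp [(x.zeroColor_eq_none i).mpr ⟨B, hB, hi⟩]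
      · have h : b.color ⟨i, hi⟩ • s₀ ∉ Oᶜ := fun h => h ((hO.mem_iff _).mpr ⟨_, rfl⟩)
        simp [hb.1 i hi, h]

theorem mem_orbitToBlock_blocks [Finite G] {hO : IsFreeOrbit O s₀} {x : DowlingPoset n G S}
    {B : Block n G} : B ∈ (orbitToBlock hO x).blocks ↔
      B ∈ x.blocks ∨ ∃ b, Represents s₀ x b ∧ B = Block.mk b := by
  simp [orbitToBlock]

theorem orbitToBlock_zeroColor [Finite G] {hO : IsFreeOrbit O s₀} {x : DowlingPoset n G S}
    {i : Fin n} {t : ↥(Oᶜ)} :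
    (orbitToBlock hO x).zeroColor i = some t ↔ x.zeroColor i = some t.1 := by
  simp only [orbitToBlock, Option.bind_eq_some_iff]
  constructor
  · rintro ⟨s, hs, h⟩
    split_ifs at h with hs'
    cases h
    exact hs
  · intro h
    have := t.2
    exact ⟨t, h, by simp⟩

theorem orbitToBlock_zeroColor_congr [Finite G] {hO : IsFreeOrbit O s₀}
    {x y : DowlingPoset n G S} {i : Fin n}
    (h : ∀ t ∉ O, x.zeroColor i = some t ↔ y.zeroColor i = some t) :
    (orbitToBlock hO x).zeroColor i = (orbitToBlock hO y).zeroColor i := by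
  refine Option.ext fun t => ?_
  rw [orbitToBlock_zeroColor, orbitToBlock_zeroColor]
  exact h t.1 t.2

/-! ### Monotonicity of `orbitToBlock` -/

/-- Merging leaves the zero block alone, so the orbit block does not change; being disjoint from the
blocks of `x`, it is neither of the two merged blocks. -/
theorem Merge.orbitToBlock [Finite G] (hO : IsFreeOrbit O s₀) {x y : DowlingPoset n G S}
    (h : Merge x y) : Merge (orbitToBlock hO x) (orbitToBlock hO y) := by
  classical
  obtain ⟨a, b, c, g, ha, hb, hab, hs, hca, hcb, hy, hz⟩ := h
  refine ⟨a, b, c, g, mem_orbitToBlock_blocks.mpr (Or.inl ha),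
    mem_orbitToBlock_blocks.mpr (Or.inl hb), hab, hs, hca, hcb, ?_, ?_⟩
  · ext D
    have hrep : ∀ d, Represents s₀ y d ↔ Represents s₀ x d := fun d =>
      Represents.congr fun i g => by rw [hz]
    have hne : (∃ d, Represents s₀ x d ∧ D = Block.mk d) → D ≠ Block.mk a ∧ D ≠ Block.mk b := by
      rintro ⟨d, hd, rfl⟩
      exact ⟨fun h => hd.notMem (h ▸ ha), fun h => hd.notMem (h ▸ hb)⟩
    simp only [mem_orbitToBlock_blocks, hy, Finset.mem_insert, Finset.mem_sdiff,
      Finset.mem_singleton, hrep]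
    generalize (∃ d, Represents s₀ x d ∧ D = Block.mk d) = p at hne ⊢
    tauto
  · funext i
    exact orbitToBlock_zeroColor_congr fun t _ => by rw [hz]

/-- There are three cases. A color `s ∉ O` gives the same color step. For `s ∈ O`, the block `b` is
merged into the orbit block if there already is one; otherwise `b` itself becomes the orbit block
and the image does not change. -/
theorem Color.orbitToBlock_le [Finite G] (hO : IsFreeOrbit O s₀) {x y : DowlingPoset n G S}
    (h : Color x y) : orbitToBlock hO x ≤ orbitToBlock hO y := by
  classical
  obtain ⟨b, s, hb, hy, hz, hz'⟩ := h
  have hxb : ∀ i ∈ b.support, x.zeroColor i = none := fun i hi =>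
    (x.zeroColor_eq_none i).mpr ⟨_, hb, hi⟩
  by_cases hs : s ∈ O
  · obtain ⟨g, rfl⟩ := (hO.mem_iff s).mp hs
    have hzero : (orbitToBlock hO y).zeroColor = (orbitToBlock hO x).zeroColor := by
      funext i
      by_cases hi : i ∈ b.support
      · refine orbitToBlock_zeroColor_congr fun t ht => ?_
        rw [hxb i hi, hz i hi]
        refine iff_of_false (fun h => ?_) (by simp)
        cases h
        exact ht (O.smul_mem _ hs)
      · exact orbitToBlock_zeroColor_congr fun t ht => by rw [hz' i hi]
    by_cases hex : ∃ a, Represents s₀ x a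
    · obtain ⟨a, ha⟩ := hex
      have hdis : Disjoint b.support a.support := ha.disjoint hb
      -- With `s = g • s₀`, the new color `b(i) • s` equals `(b(i) g) • s₀`, so `g` is the twist in
      -- the merge.
      let c : ColoredSet n G := ⟨a.support ∪ b.support,
        a.nonempty.mono Finset.subset_union_left,
        fun i => if h : i.1 ∈ a.support then a.color ⟨i, h⟩ else
          b.color ⟨i, (Finset.mem_union.mp i.2).resolve_left h⟩ * g⟩
      have hca : ∀ (i : Fin n) (hc : i ∈ c.support) (ha : i ∈ a.support),
          c.color ⟨i, hc⟩ = a.color ⟨i, ha⟩ := fun i hc ha => dif_pos ha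
      have hcb : ∀ (i : Fin n) (hc : i ∈ c.support) (hb : i ∈ b.support),
          c.color ⟨i, hc⟩ = b.color ⟨i, hb⟩ * g := fun i hc hb =>
        dif_neg (Finset.disjoint_left.mp hdis hb)
      have hc : Represents s₀ y c := by
        constructor
        · intro i hi
          rcases Finset.mem_union.mp hi with hia | hib
          · rw [hca i hi hia, hz' i fun hib => Finset.disjoint_left.mp hdis hib hia]
            exact ha.1 i hia
          · rw [hcb i hi hib, hz i hib, mul_smul]
        · intro i g' hi
          by_cases hib : i ∈ b.support
          · exact Finset.mem_union_right _ hib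
          · rw [hz' i hib] at hi
            exact Finset.mem_union_left _ (ha.2 i g' hi)
      have hrx : ∀ D, (∃ d, Represents s₀ x d ∧ D = Block.mk d) ↔ D = Block.mk a := fun D =>
        ⟨fun ⟨d, hd, h⟩ => h.trans (hd.mk_eq hO ha), fun h => ⟨a, ha, h⟩⟩
      have hry : ∀ D, (∃ d, Represents s₀ y d ∧ D = Block.mk d) ↔ D = Block.mk c := fun D =>
        ⟨fun ⟨d, hd, h⟩ => h.trans (hd.mk_eq hO hc), fun h => ⟨c, hc, h⟩⟩
      refine Relation.ReflTransGen.single (Or.inl ⟨a, b, c, g,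
        mem_orbitToBlock_blocks.mpr (Or.inr ⟨a, ha, rfl⟩),
        mem_orbitToBlock_blocks.mpr (Or.inl hb), fun h => ha.notMem (h ▸ hb), rfl, hca, hcb, ?_,
        hzero⟩)
      ext D
      have hne : D ∈ x.blocks → D ≠ Block.mk a := fun h h' => ha.notMem (h' ▸ h)
      simp only [mem_orbitToBlock_blocks, hy, Finset.mem_insert, Finset.mem_sdiff,
        Finset.mem_singleton, hrx, hry]
      tauto
    · let c : ColoredSet n G := ⟨b.support, b.nonempty, fun i => b.color i * g⟩
      have hcb : Block.mk c = Block.mk b := Block.mk_eq_mk.mpr ⟨rfl, g, fun _ _ _ => rfl⟩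
      have hc : Represents s₀ y c := by
        constructor
        · intro i hi
          exact (hz i hi).trans (by rw [← mul_smul])
        · intro i g' hi
          by_contra hib
          rw [hz' i hib] at hi
          exact hex (exists_represents hi)
      have hry : ∀ D, (∃ d, Represents s₀ y d ∧ D = Block.mk d) ↔ D = Block.mk b := fun D =>
        ⟨fun ⟨d, hd, h⟩ => h.trans ((hd.mk_eq hO hc).trans hcb), fun h => ⟨c, hc, h.trans hcb.symm⟩⟩
      have hrx : ∀ D, ¬ ∃ d, Represents s₀ x d ∧ D = Block.mk d := fun D ⟨d, hd, _⟩ => hex ⟨d, hd⟩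
      refine le_of_eq (DowlingPoset.ext ?_ hzero.symm)
      ext D
      have hD : D = Block.mk b → D ∈ x.blocks := fun h => h ▸ hb
      simp only [mem_orbitToBlock_blocks, hy, Finset.mem_sdiff, Finset.mem_singleton, hrx, hry]
      tauto
  · have hsg : ∀ g : G, g • s ∉ O := fun g h => hs ((O.smul_mem_iff' g).mp h)
    have hrep : ∀ d, Represents s₀ y d ↔ Represents s₀ x d := fun d => Represents.congr fun i g => by
      by_cases hi : i ∈ b.support
      · rw [hxb i hi, hz i hi]
        refine iff_of_false (fun h => ?_) (by simp)
        exact hsg _ ((hO.mem_iff _).mpr ⟨g, Option.some_injective _ h⟩)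
      · rw [hz' i hi]
    refine Relation.ReflTransGen.single (Or.inr ⟨b, ⟨s, hs⟩,
      mem_orbitToBlock_blocks.mpr (Or.inl hb), ?_, ?_, ?_⟩)
    · ext D
      have hne : (∃ d, Represents s₀ x d ∧ D = Block.mk d) → D ≠ Block.mk b := by
        rintro ⟨d, hd, rfl⟩ h
        exact hd.notMem (h ▸ hb)
      simp only [mem_orbitToBlock_blocks, hy, Finset.mem_sdiff, Finset.mem_singleton, hrep]
      generalize (∃ d, Represents s₀ x d ∧ D = Block.mk d) = p at hne ⊢
      tauto
    · intro i hi
      rw [orbitToBlock_zeroColor, hz i hi]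
      rfl
    · intro i hi
      exact orbitToBlock_zeroColor_congr fun t _ => by rw [hz' i hi]

theorem orbitToBlock_mono [Finite G] (hO : IsFreeOrbit O s₀) :
    Monotone (orbitToBlock (n := n) hO) := by
  intro x y h
  induction h with
  | refl => exact le_rfl
  | tail _ h ih =>
    exact ih.trans (h.elim (fun h => Relation.ReflTransGen.single (Or.inl (h.orbitToBlock hO)))
      (fun h => h.orbitToBlock_le hO))

/-! ### The inclusion as a right inverse of `orbitToBlock` -/

/-- The inclusion of Dowling posets given by an invariant subset of the set of colors. -/
def inclusion {N : SubMulAction G S} (x : DowlingPoset n G N) : DowlingPoset n G S where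
  blocks := x.blocks
  disjoint := x.disjoint
  zeroColor i := (x.zeroColor i).map Subtype.val
  zeroColor_eq_none i := by rw [Option.map_eq_none_iff, x.zeroColor_eq_none]

theorem inclusion_zeroColor {N : SubMulAction G S} {x : DowlingPoset n G N} {i : Fin n} {t : S} :
    (inclusion x).zeroColor i = some t ↔ ∃ h : t ∈ N, x.zeroColor i = some ⟨t, h⟩ := by
  simp only [inclusion, Option.map_eq_some_iff]
  constructor
  · rintro ⟨a, ha, rfl⟩
    exact ⟨a.2, ha⟩
  · rintro ⟨h, ht⟩
    exact ⟨_, ht, rfl⟩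

theorem inclusion_mono {N : SubMulAction G S} :
    Monotone (inclusion (n := n) (N := N)) := by
  intro x y h
  induction h with
  | refl => exact le_rfl
  | tail _ h ih =>
    refine ih.trans (Relation.ReflTransGen.single ?_)
    rcases h with ⟨a, b, c, g, ha, hb, hab, hs, hca, hcb, hy, hz⟩ | ⟨b, s, hb, hy, hz, hz'⟩
    · refine Or.inl ⟨a, b, c, g, ha, hb, hab, hs, hca, hcb, hy, ?_⟩
      simp only [inclusion, hz]
    · refine Or.inr ⟨b, s, hb, hy, fun i hi => ?_, fun i hi => ?_⟩
      · simp [inclusion, hz i hi]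
      · simp [inclusion, hz' i hi]

theorem orbitToBlock_inclusion [Finite G] (hO : IsFreeOrbit O s₀) (x : DowlingPoset n G ↥(Oᶜ)) :
    orbitToBlock hO (inclusion x) = x := by
  refine DowlingPoset.ext ?_ ?_
  · ext D
    rw [mem_orbitToBlock_blocks]
    refine or_iff_left ?_
    rintro ⟨d, hd, -⟩
    obtain ⟨i, hi⟩ := d.nonempty
    obtain ⟨h, -⟩ := inclusion_zeroColor.mp (hd.1 i hi)
    exact h ((hO.mem_iff _).mpr ⟨_, rfl⟩)
  · funext i
    refine Option.ext fun t => ?_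
    rw [orbitToBlock_zeroColor, inclusion_zeroColor]
    exact ⟨fun ⟨_, h⟩ => h, fun h => ⟨t.2, h⟩⟩

theorem inclusion_orbitToBlock_of_not_exists [Finite G] (hO : IsFreeOrbit O s₀)
    {x : DowlingPoset n G S} (h : ¬ ∃ a, Represents s₀ x a) :
    inclusion (orbitToBlock hO x) = x := by
  refine DowlingPoset.ext ?_ ?_
  · ext D
    exact (mem_orbitToBlock_blocks (hO := hO)).trans (or_iff_left fun ⟨d, hd, _⟩ => h ⟨d, hd⟩)
  · funext i
    refine Option.ext fun t => ?_
    simp only [inclusion_zeroColor, orbitToBlock_zeroColor]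
    refine ⟨fun ⟨_, h⟩ => h, fun ht => ⟨fun htO => ?_, ht⟩⟩
    obtain ⟨g, rfl⟩ := (hO.mem_iff t).mp htO
    exact h (exists_represents ht)

/-- If the orbit block exists, a single color step with `s₀` moves it back and restores its colors;
otherwise the two sides agree. -/
theorem inclusion_orbitToBlock_le [Finite G] (hO : IsFreeOrbit O s₀) (x : DowlingPoset n G S) :
    inclusion (orbitToBlock hO x) ≤ x := by
  classical
  by_cases hex : ∃ a, Represents s₀ x a
  · obtain ⟨a, ha⟩ := hex
    refine Relation.ReflTransGen.single (Or.inr ⟨a, s₀,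
      (mem_orbitToBlock_blocks (hO := hO)).mpr (Or.inr ⟨a, ha, rfl⟩), ?_, ha.1, fun i hi => ?_⟩)
    · ext D
      have hne : D ∈ x.blocks → D ≠ Block.mk a := fun h h' => ha.notMem (h' ▸ h)
      have hrx : (∃ d, Represents s₀ x d ∧ D = Block.mk d) ↔ D = Block.mk a :=
        ⟨fun ⟨d, hd, h⟩ => h.trans (hd.mk_eq hO ha), fun h => ⟨a, ha, h⟩⟩
      have hmem : D ∈ (inclusion (orbitToBlock hO x)).blocks ↔ D ∈ x.blocks ∨ D = Block.mk a :=
        (mem_orbitToBlock_blocks (hO := hO)).trans (or_congr Iff.rfl hrx)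
      simp only [Finset.mem_sdiff, Finset.mem_singleton, hmem]
      tauto
    · refine Option.ext fun t => ?_
      simp only [inclusion_zeroColor, orbitToBlock_zeroColor]
      refine ⟨fun ht => ⟨fun htO => ?_, ht⟩, fun ⟨_, h⟩ => h⟩
      obtain ⟨g, rfl⟩ := (hO.mem_iff t).mp htO
      exact hi (ha.2 i g ht)
  · exact (inclusion_orbitToBlock_of_not_exists hO hex).le

theorem orbitToBlock_bot [Finite G] (hO : IsFreeOrbit O s₀) :
    orbitToBlock hO (⊥ : DowlingPoset n G S) = ⊥ :=
  -- Every monotone map onto a poset with a least element preserves it; here `⊥` is the image of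
  -- `inclusion ⊥`, which lies above `⊥`.
  le_bot_iff.mp ((orbitToBlock_mono hO bot_le).trans (orbitToBlock_inclusion hO ⊥).le)

theorem inclusion_ne_bot [Finite G] (hO : IsFreeOrbit O s₀) {x : DowlingPoset n G ↥(Oᶜ)}
    (hx : x ≠ ⊥) : inclusion x ≠ ⊥ := fun h =>
  hx (by rw [← orbitToBlock_inclusion hO x, h, orbitToBlock_bot])

/-! ### Restriction to the subposets without `0̂` -/

theorem mem_orbit_coe {N : SubMulAction G S} {s t : N} :
    t.1 ∈ MulAction.orbit G s.1 ↔ t ∈ MulAction.orbit G s :=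
  exists_congr fun g => (Subtype.ext_iff (a1 := g • s) (a2 := t)).symm

theorem mem_of_mem_orbit {N : SubMulAction G S} {s t : S} (hs : s ∈ N)
    (ht : t ∈ MulAction.orbit G s) : t ∈ N := by
  obtain ⟨g, rfl⟩ := ht
  exact N.smul_mem g hs

/-- Only the orbit `O` is new, and its preimage is empty, so it has 0 elements rather than 1. -/
theorem inclusion_mem_subposet {T : Set S} {x : DowlingPoset n G ↥(Oᶜ)}
    (hx : x ∈ subposet n G (Subtype.val ⁻¹' T : Set ↥(Oᶜ))) : inclusion x ∈ subposet n G T := by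
  intro s hs
  by_cases hsO : s ∈ O
  · have h : {i : Fin n | ∃ t ∈ MulAction.orbit G s, (inclusion x).zeroColor i = some t} = ∅ := by
      refine Set.eq_empty_of_forall_notMem ?_
      rintro i ⟨t, ht, hi⟩
      obtain ⟨h, -⟩ := inclusion_zeroColor.mp hi
      exact h (mem_of_mem_orbit hsO ht)
    rw [h]
    simp
  · convert hx ⟨s, hsO⟩ (fun t ht => hs (mem_orbit_coe.mpr ht)) using 3
    ext i
    constructor
    · rintro ⟨t, ht, hi⟩
      obtain ⟨h, hi⟩ := inclusion_zeroColor.mp hi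
      exact ⟨⟨t, h⟩, mem_orbit_coe.mp ht, hi⟩
    · rintro ⟨t, ht, hi⟩
      exact ⟨t, mem_orbit_coe.mpr ht, inclusion_zeroColor.mpr ⟨t.2, hi⟩⟩

theorem orbitToBlock_mem_subposet [Finite G] (hO : IsFreeOrbit O s₀) {T : Set S}
    {x : DowlingPoset n G S} (hx : x ∈ subposet n G T) :
    orbitToBlock hO x ∈ subposet n G (Subtype.val ⁻¹' T : Set ↥(Oᶜ)) := by
  intro s hs
  have hsT : MulAction.orbit G s.1 ⊆ Tᶜ := fun t ht =>
    hs (mem_orbit_coe (t := ⟨t, mem_of_mem_orbit s.2 ht⟩).mp ht)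
  convert hx s.1 hsT using 3
  ext i
  constructor
  · rintro ⟨t, ht, hi⟩
    exact ⟨t, mem_orbit_coe.mpr ht, orbitToBlock_zeroColor.mp hi⟩
  · rintro ⟨t, ht, hi⟩
    exact ⟨⟨t, mem_of_mem_orbit s.2 ht⟩, mem_orbit_coe.mp ht, orbitToBlock_zeroColor.mpr hi⟩

/-- If the image were `0̂`, an orbit block would be a singleton, and `|z⁻¹(O)| = 1` is excluded
because `O` avoids `T`. Without an orbit block nothing is changed, and `x` itself would be `0̂`. -/
theorem orbitToBlock_ne_bot [Finite G] (hO : IsFreeOrbit O s₀) {T : Set S}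
    (hOT : (O : Set S) ⊆ Tᶜ) {x : DowlingPoset n G S} (hx : x ∈ subposet n G T) (hne : x ≠ ⊥) :
    orbitToBlock hO x ≠ ⊥ := by
  intro h
  by_cases hex : ∃ a, Represents s₀ x a
  · obtain ⟨a, ha⟩ := hex
    have hmem : Block.mk a ∈ (orbitToBlock hO x).blocks :=
      mem_orbitToBlock_blocks.mpr (Or.inr ⟨a, ha, rfl⟩)
    rw [h, mem_blocks_bot] at hmem
    obtain ⟨i, hi⟩ := hmem
    have hs : a.support = {i} := (congrArg Block.support hi).symm
    have hs₀ : s₀ ∈ O := (hO.mem_iff s₀).mpr ⟨1, (one_smul G s₀).symm⟩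
    refine hx s₀ (fun t ht => hOT (mem_of_mem_orbit hs₀ ht)) (Set.ncard_eq_one.mpr ⟨i, ?_⟩)
    ext j
    rw [Set.mem_singleton_iff, ← Finset.mem_singleton, ← hs]
    constructor
    · rintro ⟨_, ⟨g, rfl⟩, hj⟩
      exact ha.2 j g hj
    · intro hj
      exact ⟨_, ⟨_, rfl⟩, ha.1 j hj⟩
  · have hbot : inclusion (orbitToBlock hO x) ≤ ⊥ := by
      rw [h, ← orbitToBlock_bot hO]
      exact inclusion_orbitToBlock_le hO ⊥
    rw [inclusion_orbitToBlock_of_not_exists hO hex] at hbot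
    exact hne (le_bot_iff.mp hbot)

end DowlingPoset

end

/-- Orbit reduction: if `O ⊆ S \ T` is a `G`-orbit with trivial stabilizer, then
`P_n(G,S,T) \ {0̂}` and `P_n(G,S \ O,T) \ {0̂}` are homotopy equivalent. -/
theorem mainTheorem6 (n : ℕ) (G S : Type*) [Group G] [Finite G] [Finite S] [MulAction G S]
    (T : Set S) (hT : ∀ (g : G), ∀ s ∈ T, g • s ∈ T)
    (O : SubMulAction G S) (hO : ∃ s : S, (O : Set S) = MulAction.orbit G s)
    (hOT : (O : Set S) ⊆ Tᶜ) (hstab : ∀ s ∈ O, MulAction.stabilizer G s = ⊥) :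
    PosetHomotopyEquivalent
      (SubposetBar n G T)
      (SubposetBar n G (Subtype.val ⁻¹' T : Set ↥(Oᶜ))) := by
  obtain ⟨s₀, hs₀⟩ := hO
  have hmem : ∀ t, t ∈ O ↔ t ∈ MulAction.orbit G s₀ := fun t => by
    rw [← hs₀, SetLike.mem_coe]
  have hO : IsFreeOrbit O s₀ := by
    refine ⟨fun t => (hmem t).trans (exists_congr fun g => eq_comm), fun g h hgh => ?_⟩
    have h1 : h⁻¹ * g ∈ MulAction.stabilizer G s₀ := by
      rw [MulAction.mem_stabilizer_iff, mul_smul, hgh, inv_smul_smul]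
    rw [hstab s₀ ((hmem s₀).mpr (MulAction.mem_orbit_self s₀)), Subgroup.mem_bot] at h1
    exact (inv_mul_eq_one.mp h1).symm
  exact .of_le_id
    ⟨fun x => ⟨DowlingPoset.orbitToBlock hO x.1, DowlingPoset.orbitToBlock_mem_subposet hO x.2.1,
        DowlingPoset.orbitToBlock_ne_bot hO hOT x.2.1 x.2.2⟩,
      fun _ _ h => DowlingPoset.orbitToBlock_mono hO h⟩
    ⟨fun x => ⟨DowlingPoset.inclusion x.1, DowlingPoset.inclusion_mem_subposet x.2.1,
        DowlingPoset.inclusion_ne_bot hO x.2.2⟩,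
      fun _ _ h => DowlingPoset.inclusion_mono h⟩
    (fun x => DowlingPoset.inclusion_orbitToBlock_le hO x.1)
    (fun x => Subtype.ext (DowlingPoset.orbitToBlock_inclusion hO x.1))
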